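/- Let $\mathbb H=\left\{\left(\begin{smallmatrix}1&a&b\\0&1&c\\0&0&1\end{smallmatrix}\right):a,b,c\in\mathbb Z\right\}$ be the discrete Heisenberg group, $\mathbb Z[\mathbb H]$ its integral group ring, and $\mathbb T=\mathbb R/\mathbb Z$. Write $(u\cdot v)_\delta=\sum_{\gamma\in\mathbb H}u_\gamma v_{\gamma^{-1}\delta}$ for the convolution of real families $u,v\in\mathbb R^{\mathbb H}$ (whenever these series converge absolutely), $(u^*)_\gamma=u_{\gamma^{-1}}$, and identify $f=\sum_\gamma f_\gamma\gamma\in\mathbb Z[\mathbb H]$ with the family $(f_\gamma)$; put $\|f\|_1=\sum_\gamma|f_\gamma|$. For $f\in\mathbb Z[\mathbb H]$ let $$X_f=\Bigl\{x\in\mathbb T^{\mathbb H}:\ \sum_{\gamma\in\mathbb H}f_\gamma\,x_{\delta\gamma}=0\ \text{ for every }\delta\in\mathbb H\Bigr\}.$$ Let $f\in\mathbb Z[\mathbb H]$ be irreducible (not a unit, and in every factorization $f=ab$ in $\mathbb Z[\mathbb H]$ one of $a,b$ is a unit), and let $f^\sharp\in\mathbb R^{\mathbb H}$ be a formal inverse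 of $f$, i.e. $f\cdot f^\sharp=f^\sharp\cdot f=1$. Let $g$ be a central element of $\mathbb Z[\mathbb H]$ such that $g\notin\mathbb Z[\mathbb H]f$ and $g\cdot f^\sharp\in\ell^1(\mathbb H,\mathbb R)$. Define the coding map $\xi_g\colon\ell^\infty(\mathbb H,\mathbb Z)\to\mathbb T^{\mathbb H}$ by $$\xi_g(v)_\gamma=\bigl(v\cdot(g^*\cdot(f^\sharp)^*)\bigr)_\gamma \pmod 1\qquad(\gamma\in\mathbb H).$$ Then the following holds. 1. The restriction of $\xi_g$ to every bounded subset of $\ell^\infty(\mathbb H,\mathbb Z)$ is continuous, where $\ell^\infty(\mathbb H,\mathbb Z)\subset\ell^\infty(\mathbb H,\mathbb R)=\ell^1(\mathbb H,\mathbb R)'$ carries the weak$^*$-topology and $\mathbb T^{\mathbb H}$ the product topology. 2. $\xi_g\bigl(\{0,\dots,\|f\|_1-1\}^{\mathbb H}\bigr)=\xi_g\bigl(B^\infty_{\|f\|_1/2}\bigr)=\xi_g\bigl(\ell^\infty(\mathbb H,\mathbb Z)\bigr)=X_f$, where $B^\infty_K$ is the closed ball of radius $K$ around $0$ in $\ell^\infty(\mathbb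 H,\mathbb Z)$ for the supremum norm. -/

import Mathlib

open scoped MonoidAlgebra ENNReal

noncomputable section

namespace HeisenbergCoding

/-- The discrete Heisenberg group, as the group of all integer matrices
`!![1, a, b; 0, 1, c; 0, 0, 1]` inside `SL(3, ℤ)`. -/
def heisenberg : Subgroup (Matrix.SpecialLinearGroup (Fin 3) ℤ) where
  carrier := {M | ∃ a b c : ℤ, (M : Matrix (Fin 3) (Fin 3) ℤ) = !![1, a, b; 0, 1, c; 0, 0, 1]}
  one_mem' := by
    refine ⟨0, 0, 0, ?_⟩
    ext i j
    fin_cases i <;> fin_cases j <;> simp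
  mul_mem' := by
    rintro M N ⟨a, b, c, hM⟩ ⟨a', b', c', hN⟩
    refine ⟨a + a', b' + a * c' + b, c' + c, ?_⟩
    rw [Matrix.SpecialLinearGroup.coe_mul, hM, hN]
    ext i j
    fin_cases i <;> fin_cases j <;> simp [Matrix.mul_apply, Fin.sum_univ_three] <;> ring
  inv_mem' := by
    rintro M ⟨a, b, c, hM⟩
    refine ⟨-a, a * c - b, -c, ?_⟩
    rw [Matrix.SpecialLinearGroup.coe_inv, hM]
    ext i j
    fin_cases i <;> fin_cases j <;> simp [Matrix.adjugate_fin_three]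

/-- The discrete Heisenberg group `ℍ` as a type. Its integer group ring is `ℤ[ℍ]`. -/
abbrev ℍ : Type := heisenberg

/-- `𝕋 = ℝ / ℤ`. -/
abbrev 𝕋 : Type := UnitAddCircle

/-- The space `ℓ^∞(ℍ, ℤ)` of bounded integer configurations, with the supremum norm. -/
abbrev LInfZ : Type := lp (fun _ : ℍ => ℤ) ∞

/-- The Banach space `ℓ¹(ℍ, ℝ)`. -/
abbrev LOneR : Type := lp (fun _ : ℍ => ℝ) 1

/-- The norm `‖f‖₁ = ∑ |f_γ|` of an element of `ℤ[ℍ]`; it is an integer. -/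
def norm₁ (f : ℤ[ℍ]) : ℤ := ∑ γ ∈ f.coeff.support, |f.coeff γ|

/-- An element of `ℤ[ℍ]` regarded as the real family `(f_γ)` of its coefficients. -/
def toFun (f : ℤ[ℍ]) : ℍ → ℝ := fun γ => (f.coeff γ : ℝ)

/-- Convolution `(u * v)_δ = ∑_γ u_γ v_{γ⁻¹ δ}` of real families. It is used only where all these
series converge absolutely: one factor is finitely supported, or one is bounded and the other
one summable. -/
def conv (u v : ℍ → ℝ) : ℍ → ℝ := fun δ => ∑' γ : ℍ, u γ * v (γ⁻¹ * δ)

/-- The involution `(u^*)_γ = u_{γ⁻¹}` on real families. -/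
def adj (u : ℍ → ℝ) : ℍ → ℝ := fun γ => u γ⁻¹

/-- `w ∈ ℝ^ℍ` is a formal (two-sided) inverse of `f`: `f · w = w · f = 1`. -/
def IsFormalInverse (f : ℤ[ℍ]) (w : ℍ → ℝ) : Prop :=
  conv (toFun f) w = toFun 1 ∧ conv w (toFun f) = toFun 1

/-- The right shift `(ρ^γ x)_{γ'} = x_{γ' γ}` on `𝕋^ℍ`. -/
def rightShift (γ : ℍ) : (ℍ → 𝕋) →+ (ℍ → 𝕋) where
  toFun x := fun γ' => x (γ' * γ)
  map_zero' := rfl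
  map_add' _ _ := rfl

/-- The group homomorphism `ρ^f = ∑_γ f_γ ρ^γ` of `𝕋^ℍ`. -/
def rho (f : ℤ[ℍ]) : (ℍ → 𝕋) →+ (ℍ → 𝕋) :=
  ∑ γ ∈ f.coeff.support, f.coeff γ • rightShift γ

/-- The closed subgroup `X_f = ker ρ^f` of `𝕋^ℍ`. -/
def X (f : ℤ[ℍ]) : AddSubgroup (ℍ → 𝕋) := (rho f).ker

/-- Coordinatewise reduction modulo `1`. -/
def eta (w : ℍ → ℝ) : ℍ → 𝕋 := fun γ => (w γ : 𝕋)

/-- The coding map `ξ_g(v) = η(v · (g^* · (f^♯)^*))`, where `w` is the formal inverse `f^♯`. -/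
def codingMap (w : ℍ → ℝ) (g : ℤ[ℍ]) (v : LInfZ) : ℍ → 𝕋 :=
  eta (conv (fun γ => (v γ : ℝ)) (conv (adj (toFun g)) (adj w)))

/-- The weak* topology on `ℓ^∞(ℍ, ℤ) ⊆ ℓ^∞(ℍ, ℝ) = ℓ¹(ℍ, ℝ)'`: the coarsest topology for which all
pairings `v ↦ ∑_γ h_γ v_γ` with `h ∈ ℓ¹(ℍ, ℝ)` are continuous. -/
@[reducible] def weakStar : TopologicalSpace LInfZ :=
  TopologicalSpace.induced (fun v (h : LOneR) => ∑' γ : ℍ, h γ * (v γ : ℝ)) Pi.topologicalSpace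

end HeisenbergCoding

end

/-! Each coordinate of `codingMap w g v` pairs `v` with a left translate of the summable family `g ·
f^♯`; this gives weak* continuity. Since `f · (g · f^♯) = g` is integral, the image lies in `X f`
(`codingMap_mem_X`).

For surjectivity, take `x` in `X f` and find `y` in `X f` with `rho g y = x`. Lift `y` to a bounded
real family `t`. Applying `f` to `t` gives a bounded integer family `v`, and `(g · f^♯) · f = g`
shows that `v` codes `rho g y = x` (`codingMap_eq_rho`). Lifts in `[-1/2, 1/2)` give the ball; lifts
in `[0, 1)`, after a constant shift, give the cube.

The point `y` exists by duality: `X f` is the character group of `ℤ[ℍ] / ℤ[ℍ] f`, and `𝕋` is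
divisible, so it suffices that `g` acts injectively there (`mem_span_of_mul_mem_span`). The central
element `g` is a Laurent polynomial in the generator of the centre, and its prime factors stay
completely prime in `ℤ[ℍ]` (`ofLaurent_dvd_or_dvd`). If `g h = k f`, each prime factor of `g`
divides `k` and cancels, or divides `f`; in the latter case `f` is that prime times a unit, whence
`g ∈ ℤ[ℍ] f`, a contradiction. -/

open scoped MonoidAlgebra ENNReal

noncomputable section

namespace HeisenbergCoding

open scoped LaurentPolynomial

/-! ### Coordinates on the Heisenberg group -/

/-- The matrix `!![1, a, b; 0, 1, c; 0, 0, 1]` as an element of `ℍ`. -/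
def heis (a b c : ℤ) : ℍ :=
  ⟨⟨!![1, a, b; 0, 1, c; 0, 0, 1], by simp [Matrix.det_fin_three]⟩, a, b, c, rfl⟩

/-- The upper right entry. -/
def corner (h : ℍ) : ℤ := (h : Matrix.SpecialLinearGroup (Fin 3) ℤ).1 0 2

/-- The two entries next to the diagonal, that is, the image in the abelianization. -/
def diag (h : ℍ) : ℤ × ℤ :=
  ((h : Matrix.SpecialLinearGroup (Fin 3) ℤ).1 0 1, (h : Matrix.SpecialLinearGroup (Fin 3) ℤ).1 1 2)

@[simp] theorem corner_heis (a b c : ℤ) : corner (heis a b c) = b := rfl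

@[simp] theorem diag_heis (a b c : ℤ) : diag (heis a b c) = (a, c) := rfl

theorem exists_eq_heis (h : ℍ) : ∃ a b c, h = heis a b c := by
  obtain ⟨M, a, b, c, hM⟩ := h
  exact ⟨a, b, c, Subtype.ext (Subtype.ext hM)⟩

theorem heis_mul_heis (a b c a' b' c' : ℤ) :
    heis a b c * heis a' b' c' = heis (a + a') (b + b' + a * c') (c + c') := by
  apply Subtype.ext
  apply Subtype.ext
  change !![1, a, b; 0, 1, c; 0, 0, 1] * !![1, a', b'; 0, 1, c'; 0, 0, 1] =
    !![1, a + a', b + b' + a * c'; 0, 1, c + c'; 0, 0, 1]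
  ext i j
  fin_cases i <;> fin_cases j <;> simp [Matrix.mul_apply, Fin.sum_univ_three] <;> ring

theorem heis_zero : heis 0 0 0 = 1 := by
  apply Subtype.ext
  apply Subtype.ext
  change !![1, 0, 0; 0, 1, 0; 0, 0, 1] = (1 : Matrix (Fin 3) (Fin 3) ℤ)
  ext i j
  fin_cases i <;> fin_cases j <;> simp

/-- The inclusion of the centre of `ℍ`. -/
def centralHom : Multiplicative ℤ →* ℍ where
  toFun n := heis 0 n.toAdd 0
  map_one' := heis_zero
  map_mul' m n := by simp [heis_mul_heis]

/-- The inclusion of the group ring of the centre. -/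
def ofLaurent : ℤ[T;T⁻¹] →+* ℤ[ℍ] :=
  (AddMonoidAlgebra.lift ℤ ℤ[ℍ] ℤ ((MonoidAlgebra.of ℤ ℍ).comp centralHom)).toRingHom

theorem ofLaurent_single (n r : ℤ) :
    ofLaurent (.single n r) = .single (heis 0 n 0) r := by
  simp [ofLaurent, centralHom, -LaurentPolynomial.single_eq_C_mul_T]

/-- The coefficients of an element of `ℤ[ℍ]` with respect to the basis `heis a 0 c` over the group
ring of the centre. -/
def laurentCoeff : ℤ[ℍ] →+ (ℤ × ℤ →₀ ℤ[T;T⁻¹]) :=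
  (Finsupp.liftAddHom fun h : ℍ =>
    (Finsupp.singleAddHom (diag h)).comp (AddMonoidAlgebra.singleAddHom (corner h))).comp
    MonoidAlgebra.coeffAddEquiv.toAddMonoidHom

theorem laurentCoeff_single (h : ℍ) (n : ℤ) :
    laurentCoeff (.single h n) = .single (diag h) (.single (corner h) n) := by
  simp [laurentCoeff]

/-- The inverse of `laurentCoeff`. -/
def ofLaurentCoeff : (ℤ × ℤ →₀ ℤ[T;T⁻¹]) →+ ℤ[ℍ] :=
  Finsupp.liftAddHom fun q =>
    (AddMonoidHom.mulRight (.single (heis q.1 0 q.2) 1)).comp ofLaurent.toAddMonoidHom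

theorem ofLaurentCoeff_single (q : ℤ × ℤ) (r : ℤ[T;T⁻¹]) :
    ofLaurentCoeff (.single q r) = ofLaurent r * .single (heis q.1 0 q.2) 1 := by
  simp [ofLaurentCoeff]

theorem ofLaurentCoeff_laurentCoeff (a : ℤ[ℍ]) : ofLaurentCoeff (laurentCoeff a) = a := by
  induction a using MonoidAlgebra.induction_linear with
  | zero => simp
  | add x y hx hy => simp [hx, hy]
  | single h n =>
    obtain ⟨a, b, c, rfl⟩ := exists_eq_heis h
    simp [laurentCoeff_single, ofLaurentCoeff_single, ofLaurent_single, heis_mul_heis,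
      -LaurentPolynomial.single_eq_C_mul_T]

theorem laurentCoeff_injective : Function.Injective laurentCoeff :=
  Function.LeftInverse.injective ofLaurentCoeff_laurentCoeff

/-- The group ring is a twisted group ring of `ℤ × ℤ` over the Laurent polynomials; the twist is the
corner entry `a * c'` of a product. -/
theorem laurentCoeff_mul (x y : ℤ[ℍ]) :
    laurentCoeff (x * y) = (laurentCoeff x).sum fun p r => (laurentCoeff y).sum fun q s =>
      .single (p + q) (.T (p.1 * q.2) * r * s) := by
  induction x using MonoidAlgebra.induction_linear with
  | zero => simp
  | add x₁ x₂ h₁ h₂ =>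
    rw [add_mul, map_add, h₁, h₂, map_add, Finsupp.sum_add_index']
    · simp
    · intros; simp [← Finsupp.sum_add, mul_add, add_mul]
  | single h m =>
    induction y using MonoidAlgebra.induction_linear with
    | zero => simp
    | add x₁ x₂ h₁ h₂ =>
      rw [mul_add, map_add, h₁, h₂, map_add, ← Finsupp.sum_add]
      congr 1
      ext1 p
      ext1 r
      rw [Finsupp.sum_add_index']
      · simp
      · intros; simp [mul_add]
    | single k n =>
      obtain ⟨a, b, c, rfl⟩ := exists_eq_heis h
      obtain ⟨a', b', c', rfl⟩ := exists_eq_heis k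
      rw [MonoidAlgebra.single_mul_single, heis_mul_heis, laurentCoeff_single,
        laurentCoeff_single, laurentCoeff_single, Finsupp.sum_single_index,
        Finsupp.sum_single_index, LaurentPolynomial.T, AddMonoidAlgebra.single_mul_single,
        AddMonoidAlgebra.single_mul_single, one_mul]
      · simp only [diag_heis, corner_heis, Prod.mk_add_mk]
        rw [show b + b' + a * c' = a * c' + b + b' by ring]
      · simp
      · simp

theorem laurentCoeff_ofLaurent (r : ℤ[T;T⁻¹]) : laurentCoeff (ofLaurent r) = .single 0 r := by
  induction r using AddMonoidAlgebra.induction_linear with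
  | zero => simp
  | add x y hx hy => simp [hx, hy]
  | single n m =>
    rw [ofLaurent_single, laurentCoeff_single, diag_heis, corner_heis, Prod.mk_zero_zero]

theorem laurentCoeff_ofLaurent_mul (r : ℤ[T;T⁻¹]) (x : ℤ[ℍ]) :
    laurentCoeff (ofLaurent r * x) = r • laurentCoeff x := by
  rw [laurentCoeff_mul, laurentCoeff_ofLaurent, Finsupp.sum_single_index]
  · simp only [zero_add, Prod.fst_zero, zero_mul, LaurentPolynomial.T_zero, one_mul]
    conv_rhs => rw [← Finsupp.sum_single (laurentCoeff x), Finsupp.smul_sum]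
    simp
  · simp

theorem ofLaurent_mul_right_injective {r : ℤ[T;T⁻¹]} (hr : r ≠ 0) {x y : ℤ[ℍ]}
    (h : ofLaurent r * x = ofLaurent r * y) : x = y := by
  apply laurentCoeff_injective
  have := congrArg laurentCoeff h
  rw [laurentCoeff_ofLaurent_mul, laurentCoeff_ofLaurent_mul] at this
  ext1 q
  have := DFunLike.congr_fun this q
  exact mul_left_cancel₀ hr this

theorem ofLaurent_commute (r : ℤ[T;T⁻¹]) (x : ℤ[ℍ]) : Commute (ofLaurent r) x := by
  induction r using AddMonoidAlgebra.induction_linear with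
  | zero => simp
  | add y z hy hz => rw [map_add]; exact hy.add_left hz
  | single n m =>
    rw [ofLaurent_single]
    apply MonoidAlgebra.single_commute
    · intro h
      obtain ⟨a, b, c, rfl⟩ := exists_eq_heis h
      simp [Commute, SemiconjBy, heis_mul_heis, add_comm]
    · exact fun r => Commute.all _ _

theorem ofLaurent_dvd_iff (r : ℤ[T;T⁻¹]) (x : ℤ[ℍ]) :
    ofLaurent r ∣ x ↔ ∀ q, r ∣ laurentCoeff x q := by
  constructor
  · rintro ⟨y, rfl⟩ q
    rw [laurentCoeff_ofLaurent_mul]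
    exact ⟨_, rfl⟩
  · intro h
    rw [← ofLaurentCoeff_laurentCoeff x, ← Finsupp.sum_single (laurentCoeff x), Finsupp.sum,
      map_sum]
    refine Finset.dvd_sum fun q _ => ?_
    obtain ⟨s, hs⟩ := h q
    rw [ofLaurentCoeff_single, hs, map_mul, mul_assoc]
    exact ⟨_, rfl⟩

/-- Central primes of `ℤ[ℍ]` are completely prime. -/
theorem ofLaurent_dvd_or_dvd {p : ℤ[T;T⁻¹]} (hp : Prime p) {x y : ℤ[ℍ]}
    (h : ofLaurent p ∣ x * y) : ofLaurent p ∣ x ∨ ofLaurent p ∣ y := by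
  classical
  by_contra! hxy
  simp only [ofLaurent_dvd_iff, not_forall] at hxy
  obtain ⟨⟨q₁, h₁⟩, q₂, h₂⟩ := hxy
  have key : ∀ z : ℤ[ℍ], ∀ q, ¬ p ∣ laurentCoeff z q →
      q ∈ (laurentCoeff z).support.filter fun q => ¬ p ∣ laurentCoeff z q := by
    intro z q hq
    simp only [Finset.mem_filter, Finsupp.mem_support_iff, ne_eq]
    exact ⟨fun h0 => hq (h0 ▸ dvd_zero p), hq⟩
  -- Among the indices whose coefficients `p` does not divide, some sum `a + b` arises only once.
  -- Modulo `p`, only this pair contributes to the coefficient of `x * y` there.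
  obtain ⟨a, ha, b, hb, hab⟩ := UniqueSums.uniqueAdd_of_nonempty ⟨q₁, key x q₁ h₁⟩
    ⟨q₂, key y q₂ h₂⟩
  simp only [Finset.mem_filter] at ha hb
  have hdvd := (ofLaurent_dvd_iff p (x * y)).1 h (a + b)
  rw [laurentCoeff_mul, Finsupp.sum, Finsupp.finsetSum_apply] at hdvd
  rw [← Finset.add_sum_erase _ _ ha.1, Finsupp.sum, Finsupp.finsetSum_apply,
    ← Finset.add_sum_erase _ _ hb.1, Finsupp.single_eq_same, add_assoc] at hdvd
  have aux : ∀ c d, (c ≠ a ∨ d ≠ b) → p ∣ (Finsupp.single (c + d)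
      (.T (c.1 * d.2) * laurentCoeff x c * laurentCoeff y d)) (a + b) := by
    intro c d hcd
    rw [Finsupp.single_apply]
    split_ifs with hs
    · by_cases hc : p ∣ laurentCoeff x c
      · exact (hc.mul_left _).mul_right _
      by_cases hd : p ∣ laurentCoeff y d
      · exact hd.mul_left _
      obtain ⟨rfl, rfl⟩ := hab (key x c hc) (key y d hd) hs
      simp at hcd
    · exact dvd_zero p
  rw [dvd_add_left] at hdvd
  · rcases hp.dvd_or_dvd hdvd with h | h
    · rcases hp.dvd_or_dvd h with h | h
      · exact hp.not_isUnit (isUnit_of_dvd_unit h (LaurentPolynomial.isUnit_T _))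
      · exact ha.2 h
    · exact hb.2 h
  · refine dvd_add (Finset.dvd_sum fun d hd => aux a d (.inr (Finset.ne_of_mem_erase hd)))
      (Finset.dvd_sum fun c hc => ?_)
    rw [Finsupp.sum, Finsupp.finsetSum_apply]
    exact Finset.dvd_sum fun d _ => aux c d (.inl (Finset.ne_of_mem_erase hc))

/-! ### Multiplication by a central element modulo an irreducible one -/

instance : UniqueFactorizationMonoid ℤ[T;T⁻¹] :=
  UniqueFactorizationMonoid.of_isLocalization (M := Polynomial ℤ)
    (Submonoid.powers (Polynomial.X : Polynomial ℤ)) _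

/-- Induction on the prime factors of `r`: each one is cancelled from `k`, or else divides the
irreducible `f`. The second alternative records `p ∣ r`, so that it survives the induction. -/
theorem exists_eq_mul_or_exists_dvd {f : ℤ[ℍ]} (hf : Irreducible f) {r : ℤ[T;T⁻¹]} (hr : r ≠ 0) :
    ∀ h k : ℤ[ℍ], ofLaurent r * h = k * f →
      (∃ k', h = k' * f) ∨ ∃ p c, p ∣ r ∧ IsUnit c ∧ f = ofLaurent p * c := by
  induction r using UniqueFactorizationMonoid.induction_on_prime with
  | h₁ => exact absurd rfl hr
  | h₂ r hu =>
    intro h k hk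
    obtain ⟨s, hs⟩ := hu.exists_left_inv
    refine .inl ⟨ofLaurent s * k, ?_⟩
    rw [mul_assoc, ← hk, ← mul_assoc, ← map_mul, hs, map_one, one_mul]
  | h₃ r p hr0 hp ih =>
    intro h k hk
    rw [map_mul, mul_assoc] at hk
    rcases ofLaurent_dvd_or_dvd hp ⟨_, hk.symm⟩ with ⟨k', rfl⟩ | ⟨c, hc⟩
    · rw [mul_assoc] at hk
      rcases ih hr0 _ _ (ofLaurent_mul_right_injective hp.ne_zero hk) with h | ⟨p', c, hd, hc⟩
      · exact .inl h
      · exact .inr ⟨p', c, hd.mul_left _, hc⟩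
    · rcases hf.isUnit_or_isUnit hc with hu | hu
      · exfalso
        -- If `ofLaurent p` were a unit, `p` would divide the coefficient `1` of the identity.
        obtain ⟨s, hs⟩ := hu.exists_right_inv
        have := (ofLaurent_dvd_iff p 1).1 ⟨s, hs.symm⟩ 0
        rw [← map_one ofLaurent, laurentCoeff_ofLaurent, Finsupp.single_eq_same] at this
        exact hp.not_isUnit (isUnit_of_dvd_one this)
      · exact .inr ⟨p, c, dvd_mul_right _ _, hu, hc⟩

theorem coeff_conj_of_mem_center {g : ℤ[ℍ]} (hg : g ∈ Subring.center ℤ[ℍ]) (k h : ℍ) :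
    g.coeff (k * h * k⁻¹) = g.coeff h := by
  have := congrArg (fun x : ℤ[ℍ] => x.coeff (k * h))
    (Subring.mem_center_iff.1 hg (.single k 1))
  rw [MonoidAlgebra.coeff_single_mul_eq_mul_coeff h (by simp),
    MonoidAlgebra.coeff_mul_single_eq_coeff_mul (k * h * k⁻¹)
      (by intros; rw [eq_mul_inv_iff_mul_eq])] at this
  simpa using this.symm

theorem coeff_heis_of_mem_center {g : ℤ[ℍ]} (hg : g ∈ Subring.center ℤ[ℍ]) (a b c k l : ℤ) :
    g.coeff (heis a (b + (k * c - a * l)) c) = g.coeff (heis a b c) := by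
  rw [← coeff_conj_of_mem_center hg (heis k 0 l) (heis a b c)]
  congr 1
  rw [eq_mul_inv_iff_mul_eq]
  simp only [heis_mul_heis]
  congr 1 <;> ring

/-- Coefficients of a central element are constant on conjugacy classes, and noncentral classes are
infinite: conjugating by `heis (n * c) 0 (-(n * a))` moves the corner by `n * (c * c + a * a)`. -/
theorem coeff_eq_zero_of_mem_center {g : ℤ[ℍ]} (hg : g ∈ Subring.center ℤ[ℍ]) {a b c : ℤ}
    (hac : (a, c) ≠ 0) : g.coeff (heis a b c) = 0 := by
  by_contra hne
  have hn : ∀ n : ℤ, heis a (b + n * (c * c + a * a)) c ∈ g.coeff.support := by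
    intro n
    rw [Finsupp.mem_support_iff, show b + n * (c * c + a * a) = b + ((n * c) * c - a * (-(n * a)))
      by ring, coeff_heis_of_mem_center hg]
    exact hne
  have hpos : c * c + a * a ≠ 0 := by
    intro h
    apply hac
    have : a = 0 := by nlinarith
    have : c = 0 := by nlinarith
    simp [*]
  refine (Set.infinite_of_injective_forall_mem (f := fun n : ℤ => heis a (b + n * (c * c + a * a)) c)
    ?_ hn) (Finset.finite_toSet _)
  intro m n hmn
  have := congrArg corner hmn
  simpa [hpos] using this

theorem exists_ofLaurent_eq {g : ℤ[ℍ]} (hg : g ∈ Subring.center ℤ[ℍ]) :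
    ∃ r, g = ofLaurent r := by
  refine ⟨laurentCoeff g 0, laurentCoeff_injective ?_⟩
  rw [laurentCoeff_ofLaurent]
  suffices h : ∀ q ≠ 0, laurentCoeff g q = 0 by
    ext1 q
    by_cases hq : q = 0
    · simp [hq]
    · rw [h q hq, Finsupp.single_eq_of_ne hq]
  intro q hq
  have : laurentCoeff g = g.coeff.sum fun h n => .single (diag h) (.single (corner h) n) := rfl
  rw [this, Finsupp.sum, Finsupp.finsetSum_apply]
  refine Finset.sum_eq_zero fun h _ => ?_
  obtain ⟨a, b, c, rfl⟩ := exists_eq_heis h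
  by_cases hac : (a, c) = 0
  · rw [diag_heis, hac, Finsupp.single_eq_of_ne hq]
  · simp [coeff_eq_zero_of_mem_center hg hac]

/-- Multiplication by `g` is injective on `ℤ[ℍ] / ℤ[ℍ] f`. -/
theorem mem_span_of_mul_mem_span {f g : ℤ[ℍ]} (hf : Irreducible f)
    (hg : g ∈ Subring.center ℤ[ℍ]) (hgf : g ∉ Ideal.span {f}) {h : ℤ[ℍ]}
    (hgh : g * h ∈ Ideal.span {f}) : h ∈ Ideal.span {f} := by
  obtain ⟨r, rfl⟩ := exists_ofLaurent_eq hg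
  rw [Ideal.mem_span_singleton'] at hgf hgh ⊢
  have hr : r ≠ 0 := by
    rintro rfl
    exact hgf ⟨0, by simp⟩
  obtain ⟨k, hk⟩ := hgh
  rcases exists_eq_mul_or_exists_dvd hf hr h k hk.symm with ⟨k', hk'⟩ | ⟨p, c, ⟨s, rfl⟩, hc, hfc⟩
  · exact ⟨k', hk'.symm⟩
  · obtain ⟨d, hd⟩ := hc.exists_left_inv
    -- With `r = p * s` and `f` equal to `p` times the unit `c`, the element `g` is itself a left
    -- multiple of `f`.
    refine absurd ⟨ofLaurent s * d, ?_⟩ hgf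
    rw [hfc, (ofLaurent_commute p c).eq, mul_assoc, ← mul_assoc d, hd, one_mul, ← map_mul,
      mul_comm]

/-! ### Points of `X_f` as characters -/

/-- The additive character of `ℤ[ℍ]` given by `x : ℍ → 𝕋`. -/
def character (x : ℍ → 𝕋) : ℤ[ℍ] →+ 𝕋 :=
  (Finsupp.liftAddHom fun γ : ℍ => zmultiplesHom 𝕋 (x γ)).comp
    MonoidAlgebra.coeffAddEquiv.toAddMonoidHom

theorem character_single (x : ℍ → 𝕋) (γ : ℍ) (n : ℤ) : character x (.single γ n) = n • x γ := by
  simp [character]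

theorem rho_apply (f : ℤ[ℍ]) (x : ℍ → 𝕋) (δ : ℍ) :
    rho f x δ = f.coeff.sum fun γ n => n • x (δ * γ) := by
  simp [rho, Finsupp.sum, rightShift]

theorem rho_eq_character (f : ℤ[ℍ]) (x : ℍ → 𝕋) (δ : ℍ) :
    rho f x δ = character x (.single δ 1 * f) := by
  rw [rho_apply]
  induction f using MonoidAlgebra.induction_linear with
  | zero => simp
  | add a b ha hb =>
    rw [mul_add, map_add, ← ha, ← hb, MonoidAlgebra.coeff_add, Finsupp.sum_add_index']
    · simp
    · intros; rw [add_smul]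
  | single γ n => simp [character_single]

/-- `rho f x δ` is the character of `x` at `δ f`, and the elements `δ f` generate the left ideal
additively. -/
theorem mem_X_iff (f : ℤ[ℍ]) (x : ℍ → 𝕋) :
    x ∈ X f ↔ ∀ a ∈ Ideal.span {f}, character x a = 0 := by
  have : x ∈ X f ↔ ∀ δ, character x (.single δ 1 * f) = 0 := by
    simp only [← rho_eq_character]
    exact ⟨fun h δ => congrFun h δ, fun h => funext h⟩
  rw [this]
  constructor
  · intro h a ha
    obtain ⟨b, rfl⟩ := Ideal.mem_span_singleton'.1 ha
    induction b using MonoidAlgebra.induction_linear with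
    | zero => simp
    | add b c hb hc =>
      rw [add_mul, map_add, hb (Ideal.mem_span_singleton'.2 ⟨b, rfl⟩),
        hc (Ideal.mem_span_singleton'.2 ⟨c, rfl⟩), add_zero]
    | single γ n =>
      have : MonoidAlgebra.single γ n = n • (MonoidAlgebra.single γ 1 : ℤ[ℍ]) := by simp
      rw [this, smul_mul_assoc, map_zsmul, h, smul_zero]
  · exact fun h δ => h _ (Ideal.mem_span_singleton'.2 ⟨_, rfl⟩)

/-- If multiplication by the central element `g` is injective on `ℤ[ℍ] / ℤ[ℍ] f`, then `ρ^g` maps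
`X_f` onto itself. -/
theorem exists_rho_eq {f g : ℤ[ℍ]} (hg : g ∈ Subring.center ℤ[ℍ])
    (hinj : ∀ h, g * h ∈ Ideal.span {f} → h ∈ Ideal.span {f}) {x : ℍ → 𝕋} (hx : x ∈ X f) :
    ∃ y ∈ X f, rho g y = x := by
  let N : AddSubgroup ℤ[ℍ] := (Ideal.span {f}).toAddSubgroup
  let μ : ℤ[ℍ] ⧸ N →+ ℤ[ℍ] ⧸ N := QuotientAddGroup.map N N (AddMonoidHom.mulLeft g)
    fun a ha => Ideal.mul_mem_left (Ideal.span {f}) g ha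
  have hμ : Function.Injective μ := by
    rw [injective_iff_map_eq_zero]
    intro a ha
    obtain ⟨a, rfl⟩ := QuotientAddGroup.mk_surjective a
    exact (QuotientAddGroup.eq_zero_iff a).2
      (hinj a ((QuotientAddGroup.eq_zero_iff (N := N) (g * a)).1 ha))
  let χ : ℤ[ℍ] ⧸ N →+ 𝕋 := QuotientAddGroup.lift N (character x) fun a ha =>
    (mem_X_iff f x).1 hx a ha
  -- A divisible group is injective, so `χ` extends along the embedding `μ`.
  obtain ⟨ψ, hψ⟩ := (Module.Baer.of_divisible 𝕋).extension_property_addMonoidHom μ hμ χ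
  let y : ℍ → 𝕋 := fun γ => ψ (MonoidAlgebra.single γ 1 : ℤ[ℍ])
  have hy : ∀ a, character y a = ψ (a : ℤ[ℍ] ⧸ N) := by
    intro a
    have : character y = ψ.comp (QuotientAddGroup.mk' N) := by
      ext γ
      simp [character_single, y]
    rw [this]
    rfl
  refine ⟨y, (mem_X_iff f y).2 fun a ha => ?_, ?_⟩
  · rw [hy, (QuotientAddGroup.eq_zero_iff a).2 ha, map_zero]
  · ext1 δ
    rw [rho_eq_character, hy, Subring.mem_center_iff.1 hg]
    change (ψ.comp μ) (MonoidAlgebra.single δ 1 : ℤ[ℍ]) = x δ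
    rw [hψ]
    change character x (.single δ 1) = x δ
    rw [character_single, one_smul]

/-! ### Convolution with elements of the group ring -/

theorem tsum_mul_toFun (a : ℤ[ℍ]) (t : ℍ → ℝ) :
    ∑' γ, t γ * toFun a γ = a.coeff.sum fun γ n => (n : ℝ) * t γ := by
  rw [tsum_eq_sum (s := a.coeff.support)]
  · exact Finset.sum_congr rfl fun _ _ => mul_comm _ _
  · intro γ hγ
    simp [toFun, Finsupp.notMem_support_iff.1 hγ]

theorem conv_toFun_left (a : ℤ[ℍ]) (v : ℍ → ℝ) (δ : ℍ) :
    conv (toFun a) v δ = a.coeff.sum fun γ n => (n : ℝ) * v (γ⁻¹ * δ) := by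
  rw [← tsum_mul_toFun a fun γ => v (γ⁻¹ * δ)]
  exact tsum_congr fun _ => mul_comm _ _

theorem conv_toFun_right (a : ℤ[ℍ]) (v : ℍ → ℝ) (δ : ℍ) :
    conv v (toFun a) δ = a.coeff.sum fun γ n => (n : ℝ) * v (δ * γ⁻¹) := by
  rw [← tsum_mul_toFun a fun γ => v (δ * γ⁻¹), conv,
    ← ((Equiv.inv ℍ).trans (Equiv.mulLeft δ)).tsum_eq]
  simp

theorem conv_toFun_one (v : ℍ → ℝ) : conv v (toFun 1) = v := by
  ext δ
  simp [conv_toFun_right, MonoidAlgebra.one_def]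

/-- All sums here are finite, so `v` may be arbitrary; this matters because a formal inverse need
not be bounded. -/
theorem conv_toFun_conv_toFun (a b : ℤ[ℍ]) (v : ℍ → ℝ) :
    conv (toFun a) (conv (toFun b) v) = conv (toFun (a * b)) v := by
  ext δ
  simp only [conv_toFun_left]
  induction a using MonoidAlgebra.induction_linear with
  | zero => simp
  | add x y hx hy =>
    rw [add_mul, MonoidAlgebra.coeff_add, MonoidAlgebra.coeff_add, Finsupp.sum_add_index',
      Finsupp.sum_add_index', hx, hy]
    all_goals simp [add_mul]
  | single γ m =>
    induction b using MonoidAlgebra.induction_linear with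
    | zero => simp
    | add x y hx hy =>
      simp only [MonoidAlgebra.coeff_single, mul_add, MonoidAlgebra.coeff_add, Int.cast_zero,
        zero_mul, Finsupp.sum_single_index] at hx hy ⊢
      rw [Finsupp.sum_add_index', Finsupp.sum_add_index', ← hx, ← hy, mul_add]
      all_goals simp [add_mul]
    | single η n =>
      rw [MonoidAlgebra.single_mul_single]
      simp only [MonoidAlgebra.coeff_single]
      rw [Finsupp.sum_single_index (by simp), Finsupp.sum_single_index (by simp),
        Finsupp.sum_single_index (by simp)]
      simp [mul_assoc]

theorem conv_toFun_conv_assoc (a b : ℤ[ℍ]) (v : ℍ → ℝ) :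
    conv (conv (toFun a) v) (toFun b) = conv (toFun a) (conv v (toFun b)) := by
  ext δ
  simp only [conv_toFun_left, conv_toFun_right, Finsupp.sum, Finset.mul_sum]
  rw [Finset.sum_comm]
  refine Finset.sum_congr rfl fun _ _ => Finset.sum_congr rfl fun _ _ => ?_
  rw [mul_left_comm, mul_assoc]

/-- The substitution `γ ↦ γ⁻¹ * δ` exchanges the two convolutions up to a conjugation, which `g`
ignores. -/
theorem conv_comm_of_mem_center {g : ℤ[ℍ]} (hg : g ∈ Subring.center ℤ[ℍ]) (v : ℍ → ℝ) :
    conv v (toFun g) = conv (toFun g) v := by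
  ext δ
  rw [conv, conv, ← ((Equiv.inv ℍ).trans (Equiv.mulRight δ)).tsum_eq]
  refine tsum_congr fun γ => ?_
  have := coeff_conj_of_mem_center hg (δ⁻¹ * γ) (γ)
  simp only [toFun, Equiv.trans_apply, Equiv.inv_apply, Equiv.coe_mulRight, mul_inv_rev, inv_inv]
  rw [mul_comm, ← this]
  simp [mul_assoc]

theorem conv_adj_adj (u v : ℍ → ℝ) : conv (adj u) (adj v) = adj (conv v u) := by
  ext δ
  rw [conv, adj, conv, ← (Equiv.mulLeft δ).tsum_eq]
  refine tsum_congr fun γ => ?_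
  simp [adj, mul_comm]

theorem conv_formalInverse {f g : ℤ[ℍ]} {w : ℍ → ℝ} (hw : IsFormalInverse f w)
    (hg : g ∈ Subring.center ℤ[ℍ]) :
    conv (toFun f) (conv (toFun g) w) = toFun g ∧
      conv (conv (toFun g) w) (toFun f) = toFun g := by
  constructor
  · rw [conv_toFun_conv_toFun, Subring.mem_center_iff.1 hg, ← conv_toFun_conv_toFun, hw.1,
      conv_toFun_one]
  · rw [conv_toFun_conv_assoc, hw.2, conv_toFun_one]

theorem codingMap_apply {g : ℤ[ℍ]} (hg : g ∈ Subring.center ℤ[ℍ]) (w : ℍ → ℝ) (v : LInfZ)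
    (δ : ℍ) :
    codingMap w g v δ = ((∑' γ, (v γ : ℝ) * conv (toFun g) w (δ⁻¹ * γ) : ℝ) : 𝕋) := by
  rw [codingMap, eta, conv_adj_adj, conv_comm_of_mem_center hg, conv]
  simp [adj]

/-! ### Pairings of bounded with summable families -/

theorem summable_mul_translate {t u : ℍ → ℝ} {C : ℝ} (ht : ∀ γ, |t γ| ≤ C) (hu : Summable u)
    {e : ℍ → ℍ} (he : Function.Injective e) : Summable fun γ => t γ * u (e γ) := by
  refine .of_norm_bounded (g := fun γ => C * |u (e γ)|)
    ((hu.abs.comp_injective he).mul_left C) fun γ => ?_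
  rw [norm_mul, Real.norm_eq_abs, Real.norm_eq_abs]
  exact mul_le_mul_of_nonneg_right (ht γ) (abs_nonneg _)

theorem summable_of_memℓp_one {u : ℍ → ℝ} (hu : Memℓp u 1) : Summable u := by
  have := (memℓp_gen_iff (by simp)).1 hu
  simp only [ENNReal.toReal_one, Real.rpow_one] at this
  exact this.of_norm

theorem LInfZ.exists_bound (v : LInfZ) : ∃ C, ∀ γ, |(v γ : ℝ)| ≤ C :=
  ⟨‖v‖, fun γ => by simpa [Int.norm_eq_abs] using lp.norm_apply_le_norm (by simp) v γ⟩

/-- A uniformly bounded integer family as an element of `ℓ^∞(ℍ, ℤ)`. -/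
def LInfZ.ofBounded (v : ℍ → ℤ) (C : ℝ) (hv : ∀ γ, |(v γ : ℝ)| ≤ C) : LInfZ :=
  ⟨v, memℓp_infty ⟨C, by rintro _ ⟨γ, rfl⟩; simpa [Int.norm_eq_abs] using hv γ⟩⟩

theorem sum_mul_tsum_eq {f : ℤ[ℍ]} {t u : ℍ → ℝ} {C : ℝ} (ht : ∀ γ, |t γ| ≤ C)
    (hu : Summable u) (e : ℍ → ℍ → ℍ) (he : ∀ γ, Function.Injective (e γ)) :
    (f.coeff.sum fun γ n => (n : ℝ) * ∑' μ, t μ * u (e γ μ)) =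
      ∑' μ, t μ * f.coeff.sum fun γ n => (n : ℝ) * u (e γ μ) := by
  simp only [Finsupp.sum, ← tsum_mul_left, Finset.mul_sum]
  rw [← Summable.tsum_finsetSum fun γ _ => (summable_mul_translate ht hu (he γ)).mul_left _]
  exact tsum_congr fun μ => Finset.sum_congr rfl fun γ _ => mul_left_comm _ _ _

theorem coe_finsupp_sum (f : ℤ[ℍ]) (t : ℍ → ℝ) :
    ((f.coeff.sum fun γ n => (n : ℝ) * t γ : ℝ) : 𝕋) = f.coeff.sum fun γ n => n • (t γ : 𝕋) := by
  refine (map_sum (QuotientAddGroup.mk' (AddSubgroup.zmultiples (1 : ℝ))) _ _).trans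
    (Finset.sum_congr rfl fun γ _ => ?_)
  dsimp only
  rw [← zsmul_eq_mul, map_zsmul]
  rfl

theorem coe_sum_eq_rho (f : ℤ[ℍ]) (t : ℍ → ℝ) (δ : ℍ) :
    ((f.coeff.sum fun γ n => (n : ℝ) * t (δ * γ) : ℝ) : 𝕋) = rho f (eta t) δ := by
  rw [rho_apply, coe_finsupp_sum f fun γ => t (δ * γ)]
  rfl

theorem tsum_mul_toFun_translate (g : ℤ[ℍ]) (t : ℍ → ℝ) (δ : ℍ) :
    ∑' γ, t γ * toFun g (δ⁻¹ * γ) = g.coeff.sum fun γ n => (n : ℝ) * t (δ * γ) := by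
  rw [← tsum_mul_toFun g fun γ => t (δ * γ), ← (Equiv.mulLeft δ).tsum_eq]
  simp

/-! ### The coding map -/

section

variable {f g : ℤ[ℍ]} {w : ℍ → ℝ}

/-- Moving the finite sum over `f` inside the pairing turns `g · w` into `f · (g · w) = g`, leaving
integer combinations of the `v γ`. -/
theorem codingMap_mem_X (hw : IsFormalInverse f w) (hg : g ∈ Subring.center ℤ[ℍ])
    (hgw : Memℓp (conv (toFun g) w) 1) (v : LInfZ) : codingMap w g v ∈ X f := by
  obtain ⟨C, hC⟩ := v.exists_bound
  refine funext fun δ => ?_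
  let s : ℍ → ℝ := fun δ => ∑' γ, (v γ : ℝ) * conv (toFun g) w (δ⁻¹ * γ)
  have hs : codingMap w g v = eta s := funext fun δ => codingMap_apply hg w v δ
  rw [hs, Pi.zero_apply, ← coe_sum_eq_rho]
  have hsum : (f.coeff.sum fun γ n => (n : ℝ) * s (δ * γ)) =
      ((g.coeff.sum fun γ n => n * v (δ * γ) : ℤ) : ℝ) := by
    refine (sum_mul_tsum_eq hC (summable_of_memℓp_one hgw) (fun γ μ => (δ * γ)⁻¹ * μ)
      fun γ => mul_right_injective _).trans ?_
    simp only [mul_inv_rev, mul_assoc]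
    simp only [← conv_toFun_left, (conv_formalInverse hw hg).1]
    rw [tsum_mul_toFun_translate g fun γ => (v γ : ℝ)]
    simp [Finsupp.sum]
  rw [hsum]
  exact (AddCircle.coe_eq_zero_iff 1).2 ⟨_, by rw [zsmul_one]⟩

/-- The family `v` is `t · f^*`; moving `f` across the pairing produces `(g · w) · f = g`.
Boundedness of `t` justifies the interchange of sums. -/
theorem codingMap_eq_rho (hw : IsFormalInverse f w) (hg : g ∈ Subring.center ℤ[ℍ])
    (hgw : Memℓp (conv (toFun g) w) 1) {t : ℍ → ℝ} {C : ℝ} (ht : ∀ γ, |t γ| ≤ C) {v : LInfZ}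
    (hv : ∀ δ, (v δ : ℝ) = f.coeff.sum fun γ n => (n : ℝ) * t (δ * γ)) :
    codingMap w g v = rho g (eta t) := by
  have hu := summable_of_memℓp_one hgw
  ext1 δ
  rw [codingMap_apply hg, ← coe_sum_eq_rho]
  congr 1
  calc ∑' μ, (v μ : ℝ) * conv (toFun g) w (δ⁻¹ * μ)
      = f.coeff.sum fun γ n => (n : ℝ) * ∑' μ, t (μ * γ) * conv (toFun g) w (δ⁻¹ * μ) := by
        simp only [Finsupp.sum, ← tsum_mul_left]
        rw [← Summable.tsum_finsetSum fun γ _ => (summable_mul_translate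
          (t := fun μ => t (μ * γ)) (fun μ => ht _) hu (mul_right_injective δ⁻¹)).mul_left _]
        refine tsum_congr fun μ => ?_
        rw [hv, Finsupp.sum, Finset.sum_mul]
        exact Finset.sum_congr rfl fun γ _ => mul_assoc _ _ _
    _ = f.coeff.sum fun γ n => (n : ℝ) * ∑' ν, t ν * conv (toFun g) w (δ⁻¹ * (ν * γ⁻¹)) := by
        refine Finset.sum_congr rfl fun γ _ => ?_
        dsimp only
        rw [← (Equiv.mulRight γ⁻¹).tsum_eq]
        simp
    _ = ∑' ν, t ν * conv (conv (toFun g) w) (toFun f) (δ⁻¹ * ν) := by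
        rw [sum_mul_tsum_eq ht hu (fun γ ν => δ⁻¹ * (ν * γ⁻¹))
          fun γ => (mul_right_injective δ⁻¹).comp (mul_left_injective γ⁻¹)]
        simp [conv_toFun_right, mul_assoc]
    _ = g.coeff.sum fun γ n => (n : ℝ) * t (δ * γ) := by
        rw [(conv_formalInverse hw hg).2, tsum_mul_toFun_translate]

theorem codingMap_add (hg : g ∈ Subring.center ℤ[ℍ]) (hgw : Memℓp (conv (toFun g) w) 1)
    (v v' : LInfZ) : codingMap w g (v + v') = codingMap w g v + codingMap w g v' := by
  obtain ⟨C, hC⟩ := v.exists_bound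
  obtain ⟨C', hC'⟩ := v'.exists_bound
  have hu := summable_of_memℓp_one hgw
  ext1 δ
  rw [Pi.add_apply, codingMap_apply hg, codingMap_apply hg, codingMap_apply hg,
    ← AddCircle.coe_add, ← (summable_mul_translate hC hu (mul_right_injective δ⁻¹)).tsum_add
      (summable_mul_translate hC' hu (mul_right_injective δ⁻¹))]
  simp [add_mul]

theorem continuous_codingMap (hg : g ∈ Subring.center ℤ[ℍ])
    (hgw : Memℓp (conv (toFun g) w) 1) :
    @Continuous LInfZ (ℍ → 𝕋) weakStar Pi.topologicalSpace (codingMap w g) := by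
  let := weakStar
  refine continuous_pi fun δ => ?_
  simp only [codingMap_apply hg]
  refine (AddCircle.continuous_mk' 1).comp ?_
  let h : LOneR := ⟨fun γ => conv (toFun g) w (δ⁻¹ * γ), memℓp_gen (by
    simpa [Function.comp_def] using
      (summable_of_memℓp_one hgw).abs.comp_injective (mul_right_injective δ⁻¹))⟩
  have := (continuous_apply h).comp
    (continuous_induced_dom (f := fun (v : LInfZ) (h : LOneR) => ∑' γ : ℍ, h γ * (v γ : ℝ)))
  refine this.congr fun v => tsum_congr fun γ => mul_comm _ _

/-- Integer families coded from bounded real lifts. -/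
theorem exists_codingMap_eq (hf : Irreducible f) (hw : IsFormalInverse f w)
    (hg : g ∈ Subring.center ℤ[ℍ]) (hgf : g ∉ Ideal.span {f})
    (hgw : Memℓp (conv (toFun g) w) 1) (lift : 𝕋 → ℝ) (hlift : ∀ x, (lift x : 𝕋) = x)
    (hbdd : ∀ x, |lift x| ≤ 1) {x : ℍ → 𝕋} (hx : x ∈ X f) :
    ∃ (v : LInfZ) (y : ℍ → 𝕋), codingMap w g v = x ∧
      ∀ δ, (v δ : ℝ) = f.coeff.sum fun γ n => (n : ℝ) * lift (y (δ * γ)) := by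
  obtain ⟨y, hy, rfl⟩ := exists_rho_eq hg (fun h => mem_span_of_mul_mem_span hf hg hgf) hx
  have hly : eta (fun γ => lift (y γ)) = y := funext fun γ => hlift (y γ)
  have hint : ∀ δ, ∃ n : ℤ, (n : ℝ) = f.coeff.sum fun γ n => (n : ℝ) * lift (y (δ * γ)) := by
    intro δ
    have : ((f.coeff.sum fun γ n => (n : ℝ) * lift (y (δ * γ)) : ℝ) : 𝕋) = 0 := by
      rw [coe_sum_eq_rho f (fun γ => lift (y γ)), hly]
      exact congrFun hy δ
    obtain ⟨n, hn⟩ := (AddCircle.coe_eq_zero_iff 1).1 this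
    exact ⟨n, by simpa using hn⟩
  choose v hv using hint
  refine ⟨.ofBounded v (∑ γ ∈ f.coeff.support, |(f.coeff γ : ℝ)|) fun δ => ?_, y, ?_, hv⟩
  · rw [hv]
    refine (Finset.abs_sum_le_sum_abs _ _).trans (Finset.sum_le_sum fun γ _ => ?_)
    rw [abs_mul]
    exact mul_le_of_le_one_right (abs_nonneg _) (hbdd _)
  · rw [codingMap_eq_rho hw hg hgw (fun γ => hbdd (y γ)) hv, hly]

end

/-- The sum lies between minus the total negative part of `f` and its total positive part, an
interval of length `norm₁ f`. Since `t γ < 1`, a positive coefficient makes the upper end strict and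
a negative one the lower end, so one of the ends is excluded and `norm₁ f` integers remain. -/
theorem exists_shift {f : ℤ[ℍ]} (hf : f ≠ 0) :
    ∃ n : ℤ, ∀ t : ℍ → ℝ, (∀ γ, 0 ≤ t γ ∧ t γ < 1) → ∀ m : ℤ,
      (m : ℝ) = (f.coeff.sum fun γ n => (n : ℝ) * t γ) → 0 ≤ m + n ∧ m + n ≤ norm₁ f - 1 := by
  by_cases hpos : ∃ γ, 0 < f.coeff γ
  · obtain ⟨η, hη⟩ := hpos
    refine ⟨∑ γ ∈ f.coeff.support, max (-f.coeff γ) 0, fun t ht m hm => ?_⟩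
    have key : ((m + ∑ γ ∈ f.coeff.support, max (-f.coeff γ) 0 : ℤ) : ℝ) =
        ∑ γ ∈ f.coeff.support, ((f.coeff γ : ℝ) * t γ + max (-(f.coeff γ : ℝ)) 0) := by
      push_cast
      rw [hm, Finsupp.sum, Finset.sum_add_distrib]
    constructor
    · rw [← Int.cast_nonneg_iff (R := ℝ), key]
      refine Finset.sum_nonneg fun γ _ => ?_
      obtain ⟨h0, h1⟩ := ht γ
      rcases le_total 0 (f.coeff γ : ℝ) with h | h
      · have := le_max_right (-(f.coeff γ : ℝ)) 0
        positivity
      · have := le_max_left (-(f.coeff γ : ℝ)) 0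
        nlinarith
    · rw [Int.le_sub_one_iff, ← Int.cast_lt (R := ℝ), key, norm₁, Int.cast_sum]
      refine Finset.sum_lt_sum (fun γ _ => ?_) ⟨η, Finsupp.mem_support_iff.2 hη.ne', ?_⟩
      · obtain ⟨h0, h1⟩ := ht γ
        rw [Int.cast_abs]
        rcases le_total 0 (f.coeff γ : ℝ) with h | h
        · rw [max_eq_right (by linarith), abs_of_nonneg h]
          nlinarith
        · rw [max_eq_left (by linarith), abs_of_nonpos h]
          nlinarith
      · have hη' : (0 : ℝ) < f.coeff η := by exact_mod_cast hη
        rw [Int.cast_abs, max_eq_right (by linarith), abs_of_pos hη']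
        nlinarith [(ht η).2]
  · push Not at hpos
    -- Without positive coefficients the value `0` is attained but `-norm₁ f` is not, so the shift
    -- is one less than the total negative part.
    refine ⟨norm₁ f - 1, fun t ht m hm => ?_⟩
    have hneg : ∀ γ, (f.coeff γ : ℝ) ≤ 0 := fun γ => by exact_mod_cast hpos γ
    have h₁ : m ≤ 0 := by
      rw [← Int.cast_nonpos (R := ℝ), hm]
      exact Finset.sum_nonpos fun γ _ => mul_nonpos_of_nonpos_of_nonneg (hneg γ) (ht γ).1
    have h₂ : -norm₁ f < m := by
      rw [← Int.cast_lt (R := ℝ), hm, norm₁, Int.cast_neg, Int.cast_sum, ← Finset.sum_neg_distrib]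
      refine Finset.sum_lt_sum_of_nonempty ?_ fun γ hγ => ?_
      · rw [Finsupp.support_nonempty_iff]
        simpa using hf
      · have : (f.coeff γ : ℝ) < 0 :=
          lt_of_le_of_ne (hneg γ) (by simpa using Finsupp.mem_support_iff.1 hγ)
        rw [Int.cast_abs, abs_of_neg this]
        nlinarith [(ht γ).2]
    omega

/-- The representative in `[0, 1)`. -/
theorem exists_lift_fract :
    ∃ lift : 𝕋 → ℝ, (∀ x, (lift x : 𝕋) = x) ∧ ∀ x, 0 ≤ lift x ∧ lift x < 1 := by
  refine ⟨fun x => (AddCircle.equivIco 1 0 x : ℝ), fun x => AddCircle.coe_equivIco, fun x => ?_⟩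
  simpa using (AddCircle.equivIco 1 0 x).2

/-- The representative in `[-1/2, 1/2)`. -/
theorem exists_lift_abs_le :
    ∃ lift : 𝕋 → ℝ, (∀ x, (lift x : 𝕋) = x) ∧ ∀ x, |lift x| ≤ 1 / 2 := by
  refine ⟨fun x => (AddCircle.equivIco 1 (-1 / 2) x : ℝ), fun x => AddCircle.coe_equivIco,
    fun x => ?_⟩
  have := (AddCircle.equivIco 1 (-1 / 2) x).2
  rw [abs_le]
  constructor <;> linarith [this.1, this.2]

end HeisenbergCoding

end

open HeisenbergCoding in
theorem theorem5p1 (f : ℤ[ℍ]) (hf : Irreducible f) (w : ℍ → ℝ) (hw : IsFormalInverse f w)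
    (g : ℤ[ℍ]) (hg : g ∈ Subring.center ℤ[ℍ]) (hgf : g ∉ Ideal.span {f})
    (hgw : Memℓp (conv (toFun g) w) 1) :
    (∀ S : Set LInfZ, Bornology.IsBounded S →
      @ContinuousOn LInfZ (ℍ → 𝕋) weakStar Pi.topologicalSpace (codingMap w g) S) ∧
    codingMap w g '' {v : LInfZ | ∀ γ : ℍ, 0 ≤ v γ ∧ v γ ≤ norm₁ f - 1} = X f ∧
    codingMap w g '' Metric.closedBall (0 : LInfZ) ((norm₁ f : ℝ) / 2) = X f ∧
    codingMap w g '' Set.univ = X f := by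
  have hmem := codingMap_mem_X hw hg hgw
  have hball : ∀ x ∈ X f, ∃ v ∈ Metric.closedBall (0 : LInfZ) ((norm₁ f : ℝ) / 2),
      codingMap w g v = x := by
    intro x hx
    obtain ⟨lift, hlift, hbdd⟩ := exists_lift_abs_le
    obtain ⟨v, y, rfl, hv⟩ := exists_codingMap_eq hf hw hg hgf hgw lift hlift
      (fun x => (hbdd x).trans (by norm_num)) hx
    refine ⟨v, ?_, rfl⟩
    rw [mem_closedBall_zero_iff]
    have h0 : (0 : ℝ) ≤ norm₁ f := by
      exact_mod_cast Finset.sum_nonneg fun γ _ => abs_nonneg (f.coeff γ)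
    refine lp.norm_le_of_forall_le (by positivity) fun δ => ?_
    rw [Int.norm_eq_abs, hv, norm₁, Int.cast_sum, Finset.sum_div]
    refine (Finset.abs_sum_le_sum_abs _ _).trans (Finset.sum_le_sum fun γ _ => ?_)
    rw [abs_mul, Int.cast_abs, div_eq_mul_one_div]
    exact mul_le_mul_of_nonneg_left (hbdd _) (abs_nonneg _)
  have hcube : ∀ x ∈ X f, ∃ v : LInfZ, (∀ γ, 0 ≤ v γ ∧ v γ ≤ norm₁ f - 1) ∧
      codingMap w g v = x := by
    intro x hx
    obtain ⟨lift, hlift, hbdd⟩ := exists_lift_fract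
    obtain ⟨n, hn⟩ := exists_shift hf.ne_zero
    -- The shift by the constant `c` changes the coded point, so `x - codingMap w g c` is coded
    -- first and `c` is added afterwards.
    let c : LInfZ := .ofBounded (fun _ => n) |(n : ℝ)| fun _ => le_rfl
    obtain ⟨v, y, hvx, hv⟩ := exists_codingMap_eq hf hw hg hgf hgw lift hlift
      (fun x => abs_le.2 ⟨by linarith [(hbdd x).1], (hbdd x).2.le⟩) (sub_mem hx (hmem c))
    refine ⟨v + c, fun δ => hn _ (fun γ => hbdd (y (δ * γ))) _ (hv δ), ?_⟩
    rw [codingMap_add hg hgw, hvx, sub_add_cancel]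
  refine ⟨fun S _ => @Continuous.continuousOn _ _ weakStar _ _ _ (continuous_codingMap hg hgw), ?_, ?_, ?_⟩
  · exact Set.Subset.antisymm (by rintro _ ⟨v, _, rfl⟩; exact hmem v) hcube
  · exact Set.Subset.antisymm (by rintro _ ⟨v, _, rfl⟩; exact hmem v) hball
  · refine Set.Subset.antisymm (by rintro _ ⟨v, _, rfl⟩; exact hmem v) fun x hx => ?_
    obtain ⟨v, _, hv⟩ := hball x hx
    exact ⟨v, trivial, hv⟩
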